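/- Let $\Bbbk$ be a field of characteristic zero, let $n=2m$ be an even integer and let $S=\Bbbk[x_1,\dots,x_n]$ with the standard grading. For a homogeneous ideal $I\subset S$ and $A=S/I$, we say that the weak Lefschetz property (WLP) fails for $A$ in degree $i$ if for every linear form $\ell\in A_1$ the multiplication map $\times\ell: A_i\to A_{i+1}$ does not have maximal rank, that is, it is neither injective nor surjective. Consider the following ideals. 1. For $d\ge 5$ and $n\ge 4$, let $I=(x_1^d,\dots,x_n^d,\;x_1^3x_2^{d-3})$. 2. For $d=4$ and $n\ge 4$, let $I=(x_1^4,\dots,x_n^4,\;x_1x_2x_3x_4)$. 3. For $d=3$ and $n\ge 6$, let $I=(x_1^3,\dots,x_n^3,\;x_1x_2x_3)$. Then, in all cases, the WLP fails for $S/I$ in degree $m(d-1)-1$. -/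

import Mathlib

namespace Lefschetz

/-- The degree `i` piece `A_i` of `A = k[x_σ]/I` for the standard grading: the image in the
quotient of the space of homogeneous polynomials of degree `i`. -/
noncomputable def gradedPiece {σ k : Type*} [Field k] (I : Ideal (MvPolynomial σ k)) (i : ℕ) :
    Submodule k (MvPolynomial σ k ⧸ I) :=
  (MvPolynomial.homogeneousSubmodule σ k i).map (Ideal.Quotient.mkₐ k I).toLinearMap

theorem mul_mem_gradedPiece {σ k : Type*} [Field k] (I : Ideal (MvPolynomial σ k))
    {ℓ : MvPolynomial σ k ⧸ I} (hℓ : ℓ ∈ gradedPiece I 1) (i : ℕ)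
    (x : MvPolynomial σ k ⧸ I) (hx : x ∈ gradedPiece I i) :
    LinearMap.mulLeft k ℓ x ∈ gradedPiece I (i + 1) := by
  obtain ⟨p, hp, rfl⟩ := hℓ
  obtain ⟨q, hq, rfl⟩ := hx
  refine ⟨p * q, ?_, by simp⟩
  rw [add_comm]
  exact MvPolynomial.IsHomogeneous.mul hp hq

/-- The multiplication map `×ℓ : A_i → A_{i+1}` by a linear form `ℓ ∈ A_1`. -/
noncomputable def mulMap {σ k : Type*} [Field k] (I : Ideal (MvPolynomial σ k)) (ℓ : gradedPiece I 1) (i : ℕ) :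
    gradedPiece I i →ₗ[k] gradedPiece I (i + 1) :=
  (LinearMap.mulLeft k (ℓ : MvPolynomial σ k ⧸ I)).restrict (mul_mem_gradedPiece I ℓ.2 i)

/-- `×ℓ : A_i → A_{i+1}` has maximal rank: it is injective or surjective. -/
def HasMaximalRank {σ k : Type*} [Field k] (I : Ideal (MvPolynomial σ k)) (ℓ : gradedPiece I 1)
    (i : ℕ) : Prop :=
  Function.Injective (mulMap I ℓ i) ∨ Function.Surjective (mulMap I ℓ i)

/-- `A = k[x_σ]/I` fails the weak Lefschetz property in degree `i`: for no linear form `ℓ ∈ A_1`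
does the map `×ℓ : A_i → A_{i+1}` have maximal rank. In particular this covers the
sum of the variables. -/
def FailsWLPInDegree {σ k : Type*} [Field k] (I : Ideal (MvPolynomial σ k)) (i : ℕ) : Prop :=
  ∀ ℓ : gradedPiece I 1, ¬ HasMaximalRank I ℓ i

end Lefschetz

/-!
By the choice of the degree, the Hilbert function of `A` does not increase from `m * (d - 1) - 1` to
`m * (d - 1)`, so `×ℓ` can only have maximal rank there by being surjective. It is not, because
`A / ℓ A` is nonzero in degree `m * (d - 1)` for every linear form `ℓ`.

For the latter, split the variables into blocks and map the polynomial ring of each block to an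
algebra in which the relations and the part of `ℓ` on that block vanish: `A / ℓ A` then maps to the
tensor product of these algebras. On two variables, `ℓ` vanishes on some line, and restricting to
this line gives `k[x] / (x ^ d)`, which is nonzero in degree `d - 1`. On `d` variables with nonzero
coefficients in `ℓ`, rescaling turns `ℓ` into their sum, and one takes the coinvariant algebra of
the symmetric group: the sum and the product of the variables vanish there, and it is nonzero in
degree `d * (d - 1) / 2`.

The Hilbert series is the product of an explicit numerator and a power of `1 + T + ⋯ + T ^ (d - 1)`.
The coefficients of such a power are symmetric and unimodal, which gives the inequality.
-/

namespace Lefschetz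

universe u

section Splitting

open Polynomial

theorem exists_adjoin_root_mul_pow_ne_zero {R : Type u} [CommRing R] {f : R[X]} (hf : f.Monic)
    {c : R} (hc : c ≠ 0) {e : ℕ} (he : e < f.natDegree) :
    AdjoinRoot.of f c * AdjoinRoot.root f ^ e ≠ 0 := by
  have h := AdjoinRoot.mk_ne_zero_of_natDegree_lt hf (g := C c * X ^ e)
    (by simpa [C_mul_X_pow_eq_monomial] using hc) (by rwa [natDegree_C_mul_X_pow e c hc])
  simpa using h

/-- Adjoining the roots one at a time produces the universal splitting algebra, which is free over
`R` on the monomials dividing `∏ i, s i ^ i`. -/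
theorem exists_splitting_mul_prod_pow_ne_zero {n : ℕ} {R : Type u} [CommRing R] {f : R[X]}
    (hf : f.Monic) (hn : f.natDegree = n) {c : R} (hc : c ≠ 0) :
    ∃ (T : Type u) (_ : CommRing T) (φ : R →+* T) (s : Fin n → T),
      f.map φ = ∏ i, (X - C (s i)) ∧ φ c * ∏ i, s i ^ (i : ℕ) ≠ 0 := by
  induction n generalizing R with
  | zero =>
    refine ⟨R, inferInstance, RingHom.id R, ![], ?_, by simpa using hc⟩
    simpa using hf.natDegree_eq_zero.1 hn
  | succ n ih =>
    have hx := exists_adjoin_root_mul_pow_ne_zero hf hc (e := n) (by omega)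
    have : Nontrivial (AdjoinRoot f) := ⟨_, _, hx⟩
    let g := f.map (AdjoinRoot.of f) /ₘ (X - C (AdjoinRoot.root f))
    have hg : f.map (AdjoinRoot.of f) = (X - C (AdjoinRoot.root f)) * g :=
      (mul_divByMonic_eq_iff_isRoot.2 (AdjoinRoot.isRoot_root f)).symm
    have hgm : g.Monic := (monic_X_sub_C _).of_mul_monic_left (hg ▸ hf.map _)
    have hgn : g.natDegree = n := by
      simp [g, natDegree_divByMonic _ (monic_X_sub_C _), hf.natDegree_map, hn]
    obtain ⟨T, _, φ, s, hφ, hs⟩ := ih hgm hgn hx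
    refine ⟨T, inferInstance, φ.comp (AdjoinRoot.of f), Fin.snoc s (φ (AdjoinRoot.root f)), ?_, ?_⟩
    · simp [← map_map, hg, hφ, Fin.prod_univ_castSucc, mul_comm]
    · simpa [Fin.prod_univ_castSucc, mul_assoc, mul_comm] using hs

end Splitting

section Cokernel

open MvPolynomial

variable {k σ τ ι : Type*} [Field k]

theorem gradedPiece_ne_bot_iff {I : Ideal (MvPolynomial σ k)} {N : ℕ} :
    gradedPiece I N ≠ ⊥ ↔ ∃ p : MvPolynomial σ k, p.IsHomogeneous N ∧ p ∉ I := by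
  rw [gradedPiece, ne_eq, ← le_bot_iff, Submodule.map_le_iff_le_comap, SetLike.not_le_iff_exists]
  simp [Ideal.Quotient.eq_zero_iff_mem]

instance finiteDimensional_gradedPiece [Finite σ] (I : Ideal (MvPolynomial σ k)) (i : ℕ) :
    FiniteDimensional k (gradedPiece I i) :=
  Module.Finite.iff_fg.2 ((homogeneousSubmodule_fg _ _ i).map _)

/-- The linear form `∑ aᵢ xᵢ`. -/
noncomputable def linForm [Fintype ι] (a : ι → k) : MvPolynomial ι k :=
  ∑ i, a i • X i

theorem exists_mk_linForm_eq [Fintype ι] {I : Ideal (MvPolynomial ι k)} (ℓ : gradedPiece I 1) :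
    ∃ a, Ideal.Quotient.mk I (linForm a) = ℓ := by
  obtain ⟨_, p, hp, rfl⟩ := ℓ
  rw [homogeneousSubmodule_one_eq_span_X] at hp
  obtain ⟨a, rfl⟩ := (Submodule.mem_span_range_iff_exists_fun k).1 hp
  exact ⟨a, rfl⟩

/-- With `A = k[x]/I` and `ℓ = ∑ aᵢ xᵢ`, the degree `N` part of the cokernel `A/ℓA` of `×ℓ` is
nonzero. -/
def CokernelNeZero [Fintype ι] (I : Ideal (MvPolynomial ι k)) (a : ι → k) (N : ℕ) : Prop :=
  gradedPiece (I ⊔ Ideal.span {linForm a}) N ≠ ⊥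

theorem CokernelNeZero.anti [Fintype ι] {I J : Ideal (MvPolynomial ι k)} {a : ι → k} {N : ℕ}
    (h : CokernelNeZero J a N) (hIJ : I ≤ J) : CokernelNeZero I a N := by
  obtain ⟨p, hp, hpJ⟩ := gradedPiece_ne_bot_iff.1 h
  exact gradedPiece_ne_bot_iff.2 ⟨p, hp, fun hpI => hpJ (sup_le_sup_right hIJ _ hpI)⟩

theorem cokernelNeZero_of_aeval [Fintype ι] {T : Type*} [CommRing T] [Algebra k T]
    {I : Ideal (MvPolynomial ι k)} {a : ι → k} {N : ℕ} (t : ι → T)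
    (hI : I ≤ RingHom.ker (aeval (R := k) t)) (ha : ∑ i, a i • t i = 0) {p : MvPolynomial ι k}
    (hp : p.IsHomogeneous N) (hpt : aeval t p ≠ 0) : CokernelNeZero I a N := by
  refine gradedPiece_ne_bot_iff.2 ⟨p, hp, fun hmem => hpt ?_⟩
  have hℓ : Ideal.span {linForm a} ≤ RingHom.ker (aeval (R := k) t) := by
    simpa [Ideal.span_singleton_le_iff_mem, RingHom.mem_ker, linForm] using ha
  exact sup_le hI hℓ hmem

theorem CokernelNeZero.not_surjective [Fintype ι] {I : Ideal (MvPolynomial ι k)} {a : ι → k}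
    {i : ℕ} (h : CokernelNeZero I a (i + 1)) {ℓ : gradedPiece I 1}
    (hℓ : Ideal.Quotient.mk I (linForm a) = ℓ) : ¬ Function.Surjective (mulMap I ℓ i) := by
  intro hsurj
  obtain ⟨p, hp, hpJ⟩ := gradedPiece_ne_bot_iff.1 h
  obtain ⟨⟨_, q, _, rfl⟩, hq⟩ := hsurj ⟨Ideal.Quotient.mk I p, p, hp, rfl⟩
  have hqp : Ideal.Quotient.mk I (linForm a * q) = Ideal.Quotient.mk I p := by
    rw [map_mul, hℓ]
    exact congrArg Subtype.val hq
  have hdiff : p - linForm a * q ∈ I := Ideal.Quotient.eq.1 hqp.symm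
  have hmul : linForm a * q ∈ Ideal.span {linForm a} :=
    Ideal.mul_mem_right _ _ (Ideal.mem_span_singleton_self _)
  exact hpJ (by simpa using Ideal.add_mem _ (Ideal.mem_sup_left hdiff) (Ideal.mem_sup_right hmul))

theorem failsWLPInDegree_of_finrank_le [Fintype ι] {I : Ideal (MvPolynomial ι k)} {i : ℕ}
    (hcoker : ∀ a, CokernelNeZero I a (i + 1))
    (hrank : Module.finrank k (gradedPiece I (i + 1)) ≤ Module.finrank k (gradedPiece I i)) :
    FailsWLPInDegree I i := by
  intro ℓ hmax
  obtain ⟨a, ha⟩ := exists_mk_linForm_eq ℓ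
  refine (hcoker a).not_surjective ha (hmax.elim (fun hinj => ?_) id)
  have heq := (LinearMap.finrank_le_finrank_of_injective hinj).antisymm hrank
  exact (LinearMap.injective_iff_surjective_of_finrank_eq_finrank heq).1 hinj

theorem tmul_ne_zero {V W : Type*} [AddCommGroup V] [Module k V] [AddCommGroup W] [Module k W]
    {v : V} {w : W} (hv : v ≠ 0) (hw : w ≠ 0) : TensorProduct.tmul k v w ≠ 0 := by
  obtain ⟨f, hf⟩ := not_forall.1 (mt (Module.forall_dual_apply_eq_zero_iff k v).1 hv)
  obtain ⟨g, hg⟩ := not_forall.1 (mt (Module.forall_dual_apply_eq_zero_iff k w).1 hw)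
  intro h
  have hfg := congrArg (LinearMap.mul' k k ∘ₗ TensorProduct.map f g) h
  exact mul_ne_zero hf hg (by simpa using hfg)

/-- The ideal generated by the `d`-th powers of the variables. -/
noncomputable def powerIdeal (k ι : Type*) [Field k] (d : ℕ) : Ideal (MvPolynomial ι k) :=
  Ideal.span (Set.range fun i : ι => X i ^ d)

theorem X_pow_mem_powerIdeal {d : ℕ} (i : ι) : X i ^ d ∈ powerIdeal k ι d :=
  Ideal.subset_span ⟨i, rfl⟩

theorem powerIdeal_sup_span_le_ker {T : Type*} [CommRing T] [Algebra k T] {t : ι → T} {d : ℕ}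
    {μ : MvPolynomial ι k} (ht : ∀ i, t i ^ d = 0) (hμ : aeval t μ = 0) :
    powerIdeal k ι d ⊔ Ideal.span {μ} ≤ RingHom.ker (aeval (R := k) t) := by
  refine sup_le (Ideal.span_le.2 ?_) ((Ideal.span_singleton_le_iff_mem _).2 hμ)
  rintro _ ⟨i, rfl⟩
  simpa using ht i

open TensorProduct in
/-- The quotient of `k[x_ι]` contains the tensor product of the quotients of `k[x_σ]` and `k[x_τ]`,
in which a tensor of nonzero elements is nonzero. -/
theorem CokernelNeZero.sum [Fintype σ] [Fintype τ] [Fintype ι] (e : σ ⊕ τ ≃ ι) {d M N : ℕ}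
    {μ : MvPolynomial σ k} {a : ι → k}
    (hσ : CokernelNeZero (powerIdeal k σ d ⊔ Ideal.span {μ}) (fun i => a (e (.inl i))) M)
    (hτ : CokernelNeZero (powerIdeal k τ d) (fun i => a (e (.inr i))) N) :
    CokernelNeZero (powerIdeal k ι d ⊔ Ideal.span {rename (fun i => e (.inl i)) μ}) a (M + N) := by
  obtain ⟨p, hp, hpI⟩ := gradedPiece_ne_bot_iff.1 hσ
  obtain ⟨q, hq, hqJ⟩ := gradedPiece_ne_bot_iff.1 hτ
  set I := powerIdeal k σ d ⊔ Ideal.span {μ} ⊔ Ideal.span {linForm fun i => a (e (.inl i))}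
  set J := powerIdeal k τ d ⊔ Ideal.span {linForm fun i => a (e (.inr i))}
  let φ : MvPolynomial σ k →ₐ[k] (MvPolynomial σ k ⧸ I) ⊗[k] (MvPolynomial τ k ⧸ J) :=
    Algebra.TensorProduct.includeLeft.comp (Ideal.Quotient.mkₐ k I)
  let ψ : MvPolynomial τ k →ₐ[k] (MvPolynomial σ k ⧸ I) ⊗[k] (MvPolynomial τ k ⧸ J) :=
    Algebra.TensorProduct.includeRight.comp (Ideal.Quotient.mkₐ k J)
  have hφ : ∀ f ∈ I, φ f = 0 := fun f hf => by simp [φ, Ideal.Quotient.eq_zero_iff_mem.2 hf]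
  have hψ : ∀ f ∈ J, ψ f = 0 := fun f hf => by simp [ψ, Ideal.Quotient.eq_zero_iff_mem.2 hf]
  let t := fun i => Sum.elim (fun j => φ (X j)) (fun j => ψ (X j)) (e.symm i)
  have htφ : (aeval t).comp (rename fun i => e (.inl i)) = φ := algHom_ext fun i => by simp [t]
  have htψ : (aeval t).comp (rename fun i => e (.inr i)) = ψ := algHom_ext fun i => by simp [t]
  refine cokernelNeZero_of_aeval t (powerIdeal_sup_span_le_ker (fun i => ?_) ?_) ?_
    (p := rename (fun i => e (.inl i)) p * rename (fun i => e (.inr i)) q)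
    (hp.rename_isHomogeneous.mul hq.rename_isHomogeneous) ?_
  · obtain ⟨j | j, rfl⟩ := e.surjective i
    · rw [← hφ _ (Ideal.mem_sup_left (Ideal.mem_sup_left (X_pow_mem_powerIdeal j)))]
      simp [t]
    · rw [← hψ _ (Ideal.mem_sup_left (X_pow_mem_powerIdeal j))]
      simp [t]
  · rw [← AlgHom.comp_apply, htφ]
    exact hφ _ (Ideal.mem_sup_left (Ideal.mem_sup_right (Ideal.mem_span_singleton_self μ)))
  · have hℓφ := hφ _ (Ideal.mem_sup_right (Ideal.mem_span_singleton_self _))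
    have hℓψ := hψ _ (Ideal.mem_sup_right (Ideal.mem_span_singleton_self _))
    rw [linForm, map_sum] at hℓφ hℓψ
    simp only [map_smul] at hℓφ hℓψ
    rw [← e.sum_comp, Fintype.sum_sum_type]
    simp [t, hℓφ, hℓψ]
  · rw [map_mul, ← AlgHom.comp_apply, ← AlgHom.comp_apply, htφ, htψ]
    have hpq := tmul_ne_zero (k := k) (v := Ideal.Quotient.mk I p) (w := Ideal.Quotient.mk J q)
      (mt Ideal.Quotient.eq_zero_iff_mem.1 hpI) (mt Ideal.Quotient.eq_zero_iff_mem.1 hqJ)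
    simpa [φ, ψ] using hpq

theorem exists_sumEquiv_extending [Fintype σ] [Fintype ι] (u : σ ↪ ι) {r : ℕ}
    (h : Fintype.card ι = Fintype.card σ + r) : ∃ e : σ ⊕ Fin r ≃ ι, ∀ s, e (.inl s) = u s := by
  classical
  have hr : Fintype.card ↥(Set.range u)ᶜ = r := by
    rw [Fintype.card_compl_set, Set.card_range_of_injective u.injective]
    omega
  exact ⟨((Equiv.ofInjective u u.injective).sumCongr (Fintype.equivFinOfCardEq hr).symm).trans
    (Equiv.Set.sumCompl _), fun s => by simp⟩

theorem CokernelNeZero.extend [Fintype σ] [Fintype ι] (u : σ ↪ ι) {d M N r : ℕ}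
    (h : Fintype.card ι = Fintype.card σ + r) {μ : MvPolynomial σ k} {a : ι → k}
    (hσ : CokernelNeZero (powerIdeal k σ d ⊔ Ideal.span {μ}) (a ∘ u) M)
    (hr : ∀ b : Fin r → k, CokernelNeZero (powerIdeal k (Fin r) d) b N) :
    CokernelNeZero (powerIdeal k ι d ⊔ Ideal.span {rename u μ}) a (M + N) := by
  obtain ⟨e, he⟩ := exists_sumEquiv_extending u h
  obtain rfl : u = ⟨fun s => e (.inl s), e.injective.comp Sum.inl_injective⟩ :=
    DFunLike.ext _ _ fun s => (he s).symm
  exact CokernelNeZero.sum e hσ (hr _)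

/-- The linear form `∑ aᵢ xᵢ` vanishes on the line spanned by `c`, so it acts as zero on the
quotient `k[x]/(x ^ d)`. -/
theorem cokernelNeZero_of_line [Fintype ι] {a c : ι → k} (hc : c ≠ 0) (hac : ∑ i, a i * c i = 0)
    {d N : ℕ} (hN : N < d) {μ : MvPolynomial ι k}
    (hμ : (Polynomial.X : Polynomial k) ^ d ∣ aeval (fun i => c i • Polynomial.X) μ) :
    CokernelNeZero (powerIdeal k ι d ⊔ Ideal.span {μ}) a N := by
  obtain ⟨j, hj⟩ := Function.ne_iff.1 hc
  let π := Ideal.Quotient.mkₐ k (Ideal.span {(Polynomial.X : Polynomial k) ^ d})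
  have hπ : ∀ f, π f = 0 ↔ Polynomial.X ^ d ∣ f := fun f =>
    Ideal.Quotient.eq_zero_iff_mem.trans Ideal.mem_span_singleton
  have hcomp : ∀ f, aeval (fun i => π (c i • Polynomial.X)) f =
      π (aeval (fun i => c i • Polynomial.X) f) := fun f => (comp_aeval_apply _ π f).symm
  refine cokernelNeZero_of_aeval (fun i => π (c i • Polynomial.X))
    (powerIdeal_sup_span_le_ker (fun i => ?_) ?_) ?_ (isHomogeneous_X_pow j N) ?_
  · rw [← map_pow, hπ, smul_pow]
    exact dvd_smul_of_dvd _ dvd_rfl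
  · rwa [hcomp, hπ]
  · simp [smul_smul, ← map_smul, ← map_sum, ← Finset.sum_smul, hac]
  · rw [hcomp, ne_eq, hπ, map_pow, aeval_X, smul_pow, Polynomial.X_pow_dvd_iff]
    exact fun h => pow_ne_zero N hj (by simpa using h N hN)

theorem exists_ne_zero_sum_mul_eq_zero (a : Fin 2 → k) :
    ∃ c : Fin 2 → k, c ≠ 0 ∧ ∑ i, a i * c i = 0 ∧ (a 0 = 0 → c 1 = 0) := by
  by_cases h : a = 0
  · exact ⟨![1, 0], by simp [h]⟩
  · refine ⟨![a 1, -a 0], ?_, by simp [mul_comm], by simp⟩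
    contrapose! h
    ext i
    fin_cases i <;> simp_all

theorem cokernelNeZero_powerIdeal_fin_even {d : ℕ} (hd : 1 ≤ d) (p : ℕ) (a : Fin (2 * p) → k) :
    CokernelNeZero (powerIdeal k (Fin (2 * p)) d) a (p * (d - 1)) := by
  induction p with
  | zero =>
    refine cokernelNeZero_of_aeval (T := k) 0 (Ideal.span_le.2 ?_) (by simp)
      (by simpa using isHomogeneous_one (Fin 0) k) (by simp)
    rintro _ ⟨i, rfl⟩
    exact i.elim0
  | succ p ih =>
    have hpair (b : Fin 2 → k) :
        CokernelNeZero (powerIdeal k (Fin 2) d ⊔ Ideal.span {0}) b (d - 1) := by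
      obtain ⟨c, hc, hbc, -⟩ := exists_ne_zero_sum_mul_eq_zero b
      exact cokernelNeZero_of_line hc hbc (by omega) (by simp)
    rw [add_one_mul p, add_comm (_ * _)]
    exact ((hpair _).extend (Fin.castLEEmb (by omega)) (by simp; ring) ih).anti le_sup_left

theorem CokernelNeZero.extend_even [Fintype σ] [Fintype ι] (u : σ ↪ ι) {d M p : ℕ} (hd : 1 ≤ d)
    (h : Fintype.card ι = Fintype.card σ + 2 * p) {μ : MvPolynomial σ k} {a : ι → k}
    (hσ : CokernelNeZero (powerIdeal k σ d ⊔ Ideal.span {μ}) (a ∘ u) M) :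
    CokernelNeZero (powerIdeal k ι d ⊔ Ideal.span {rename u μ}) a (M + p * (d - 1)) :=
  hσ.extend u h (cokernelNeZero_powerIdeal_fin_even hd p)

/-- The coinvariant algebra of the symmetric group on `d` letters is the universal splitting algebra
of `X ^ d`; its socle is spanned by `∏ i, s i ^ i`. -/
theorem cokernelNeZero_of_forall_ne_zero {k : Type u} [Field k] {d : ℕ} (hd : 1 ≤ d)
    {a : Fin d → k} (ha : ∀ i, a i ≠ 0) :
    CokernelNeZero (powerIdeal k (Fin d) d ⊔ Ideal.span {∏ i, X i}) a (∑ i : Fin d, (i : ℕ)) := by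
  obtain ⟨T, _, φ, s, hφ, hs⟩ := exists_splitting_mul_prod_pow_ne_zero
    (Polynomial.monic_X_pow (R := k) d) (Polynomial.natDegree_X_pow d) one_ne_zero
  rw [map_one, one_mul] at hs
  have : Nontrivial T := ⟨_, _, hs⟩
  let _ := φ.toAlgebra
  rw [Polynomial.map_pow, Polynomial.map_X] at hφ
  have hpow (i) : s i ^ d = 0 := by
    simpa [Polynomial.eval_prod, Finset.prod_eq_zero (Finset.mem_univ i)] using
      congrArg (Polynomial.eval (s i)) hφ
  have hsum : ∑ i, s i = 0 := by
    have h := Polynomial.prod_X_sub_C_nextCoeff (s := Finset.univ) s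
    rw [← hφ, Polynomial.nextCoeff_of_natDegree_pos (by simp; omega)] at h
    simpa [Polynomial.coeff_X_pow, show d - 1 ≠ d by omega] using h
  have hprod : ∏ i, s i = 0 := by
    have h : 0 = (-1) ^ d * ∏ i, s i := by
      simpa [Polynomial.eval_prod, Finset.prod_neg, show d ≠ 0 by omega] using
        congrArg (Polynomial.eval 0) hφ
    exact (isUnit_neg_one.pow d).mul_right_eq_zero.1 h.symm
  refine cokernelNeZero_of_aeval (fun i => (a i)⁻¹ • s i)
    (powerIdeal_sup_span_le_ker (fun i => ?_) ?_) ?_ (p := ∏ i : Fin d, X i ^ (i : ℕ))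
    (IsHomogeneous.prod _ _ _ fun i _ => isHomogeneous_X_pow i _) ?_
  · rw [smul_pow, hpow, smul_zero]
  · simp [Finset.prod_smul, hprod]
  · simp [smul_smul, ha, hsum]
  · simp only [map_prod, map_pow, aeval_X, smul_pow, Finset.prod_smul]
    refine (smul_ne_zero_iff_right ?_).2 hs
    exact Finset.prod_ne_zero_iff.2 fun i _ => pow_ne_zero _ (inv_ne_zero (ha i))

theorem sum_fin_val_two_mul (q : ℕ) : ∑ i : Fin (2 * q), (i : ℕ) = q * (2 * q - 1) := by
  have h := Finset.sum_range_id_mul_two (2 * q)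
  rw [Fin.sum_univ_eq_sum_range fun i => i]
  linarith

theorem sum_fin_val_two_mul_add_one (q : ℕ) :
    ∑ i : Fin (2 * q + 1), (i : ℕ) = q * (2 * q + 1) := by
  have h := Finset.sum_range_id_mul_two (2 * q + 1)
  rw [Fin.sum_univ_eq_sum_range fun i => i]
  simp only [add_tsub_cancel_right] at h
  linarith

theorem le_of_embedding_fin_two_mul [Fintype ι] {q m : ℕ} (u : Fin (2 * q) ↪ ι)
    (hcard : Fintype.card ι = 2 * m) : q ≤ m := by
  have := Fintype.card_le_of_embedding u
  rw [Fintype.card_fin] at this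
  omega

theorem mul_dvd_prod_univ {M : Type*} [CommMonoid M] [Fintype ι] {i j : ι} (hij : i ≠ j)
    (f : ι → M) : f i * f j ∣ ∏ s, f s := by
  classical
  rw [← Finset.prod_pair hij]
  exact Finset.prod_dvd_prod_of_subset _ _ _ (Finset.subset_univ _)

theorem cokernelNeZero_of_coeff_eq_zero [Fintype ι] {d m : ℕ} (hd : 1 ≤ d)
    (hcard : Fintype.card ι = 2 * m) {a : ι → k} {i j : ι} (hij : i ≠ j) (hi : a i = 0)
    {μ : MvPolynomial ι k} (hμ : X i * X j ∣ μ) :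
    CokernelNeZero (powerIdeal k ι d ⊔ Ideal.span {μ}) a (m * (d - 1)) := by
  let u : Fin 2 ↪ ι := ⟨![i, j], by simpa [Function.Injective, Fin.forall_fin_two, eq_comm]⟩
  obtain ⟨c, hc, hac, hc1⟩ := exists_ne_zero_sum_mul_eq_zero (a ∘ u)
  have hpair : CokernelNeZero (powerIdeal k (Fin 2) d ⊔ Ideal.span {X 0 * X 1}) (a ∘ u) (d - 1) :=
    cokernelNeZero_of_line hc hac (by omega) (by simp [hc1 hi])
  obtain ⟨p, rfl⟩ := Nat.exists_eq_add_of_le (le_of_embedding_fin_two_mul (q := 1) u hcard)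
  rw [add_mul, one_mul]
  refine (hpair.extend_even u hd (by rw [hcard, Fintype.card_fin]; ring)).anti ?_
  refine sup_le_sup_left (Ideal.span_singleton_le_span_singleton.2 ?_) _
  simpa [u] using hμ

theorem cokernelNeZero_rename_prod_X_of_exists_eq_zero [Fintype σ] [Nontrivial σ] [Fintype ι]
    {d m : ℕ} (hd : 1 ≤ d) (hcard : Fintype.card ι = 2 * m) (u : σ ↪ ι) {a : ι → k}
    (ha : ∃ i, a (u i) = 0) :
    CokernelNeZero (powerIdeal k ι d ⊔ Ideal.span {rename u (∏ i, X i)}) a (m * (d - 1)) := by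
  obtain ⟨i, hi⟩ := ha
  obtain ⟨j, hji⟩ := exists_ne i
  refine cokernelNeZero_of_coeff_eq_zero hd hcard (u.injective.ne hji.symm) hi ?_
  simpa using mul_dvd_prod_univ hji.symm fun s => X (u s)

theorem cokernelNeZero_rename_X_pow_mul_X_pow [Fintype ι] {b c d m : ℕ} (hd : 1 ≤ d)
    (hbc : b + c = d) (hcard : Fintype.card ι = 2 * m) (u : Fin 2 ↪ ι) (a : ι → k) :
    CokernelNeZero (powerIdeal k ι d ⊔ Ideal.span {rename u (X 0 ^ b * X 1 ^ c)}) a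
      (m * (d - 1)) := by
  obtain ⟨v, hv, hav, -⟩ := exists_ne_zero_sum_mul_eq_zero (a ∘ u)
  have hpair : CokernelNeZero (powerIdeal k (Fin 2) d ⊔ Ideal.span {X 0 ^ b * X 1 ^ c})
      (a ∘ u) (d - 1) := by
    refine cokernelNeZero_of_line hv hav (by omega) ⟨Polynomial.C (v 0 ^ b * v 1 ^ c), ?_⟩
    simp [← hbc, Polynomial.smul_eq_C_mul]
    ring
  obtain ⟨p, rfl⟩ := Nat.exists_eq_add_of_le (le_of_embedding_fin_two_mul (q := 1) u hcard)
  rw [add_mul, one_mul]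
  exact hpair.extend_even u hd (by rw [hcard, Fintype.card_fin]; ring)

theorem cokernelNeZero_powerIdeal_fin_odd (q : ℕ) (b : Fin (2 * q + 1) → k) :
    CokernelNeZero (powerIdeal k (Fin (2 * q + 1)) (2 * q + 1)) b (q * (2 * q + 1)) := by
  by_cases hb : ∀ i, b i ≠ 0
  · rw [← sum_fin_val_two_mul_add_one]
    exact (cokernelNeZero_of_forall_ne_zero (by omega) hb).anti le_sup_left
  · obtain ⟨i, hi⟩ : ∃ i, b i = 0 := by simpa using hb
    have hone : CokernelNeZero (powerIdeal k Unit (2 * q + 1) ⊔ Ideal.span {0})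
        (b ∘ Function.Embedding.punit i) q :=
      cokernelNeZero_of_line one_ne_zero (by simpa [Function.Embedding.punit] using hi) (by omega)
        (by simp)
    have h := hone.extend_even (ι := Fin (2 * q + 1)) (a := b) (.punit i) (p := q) (by omega)
      (by simp; ring)
    convert h.anti le_sup_left using 1
    simp
    ring

theorem cokernelNeZero_rename_prod_X_of_even [Fintype ι] {q m : ℕ} (hq : 1 ≤ q)
    (hcard : Fintype.card ι = 2 * m) (u : Fin (2 * q) ↪ ι) (a : ι → k) :
    CokernelNeZero (powerIdeal k ι (2 * q) ⊔ Ideal.span {rename u (∏ i, X i)}) a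
      (m * (2 * q - 1)) := by
  by_cases ha : ∀ i, a (u i) ≠ 0
  · obtain ⟨p, rfl⟩ := Nat.exists_eq_add_of_le (le_of_embedding_fin_two_mul u hcard)
    rw [add_mul, ← sum_fin_val_two_mul]
    exact (cokernelNeZero_of_forall_ne_zero (by omega) ha).extend_even u (by omega)
      (by rw [hcard, Fintype.card_fin]; ring)
  · have : Nontrivial (Fin (2 * q)) := Fin.nontrivial_iff_two_le.2 (by omega)
    exact cokernelNeZero_rename_prod_X_of_exists_eq_zero (by omega) hcard u (by simpa using ha)

theorem cokernelNeZero_rename_prod_X_of_odd [Fintype ι] {q m : ℕ} (hq : 1 ≤ q)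
    (hcard : Fintype.card ι = 2 * m) (hm : 2 * q + 1 ≤ m) (u : Fin (2 * q + 1) ↪ ι) (a : ι → k) :
    CokernelNeZero (powerIdeal k ι (2 * q + 1) ⊔ Ideal.span {rename u (∏ i, X i)}) a
      (m * (2 * q)) := by
  by_cases ha : ∀ i, a (u i) ≠ 0
  · obtain ⟨p, rfl⟩ := Nat.exists_eq_add_of_le hm
    have hrest (b : Fin (2 * q + 1 + 2 * p) → k) :
        CokernelNeZero (powerIdeal k _ (2 * q + 1)) b (q * (2 * q + 1) + p * (2 * q)) := by
      have hodd := (cokernelNeZero_powerIdeal_fin_odd q (b ∘ Fin.castAddEmb _)).anti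
        (I := powerIdeal k _ (2 * q + 1) ⊔ Ideal.span {0}) (by simp)
      exact (hodd.extend_even _ (by omega) (by simp)).anti le_sup_left
    convert (cokernelNeZero_of_forall_ne_zero (by omega) ha).extend u
      (by rw [hcard, Fintype.card_fin]; ring) hrest using 1
    rw [sum_fin_val_two_mul_add_one]
    ring
  · have : Nontrivial (Fin (2 * q + 1)) := Fin.nontrivial_iff_two_le.2 (by omega)
    exact cokernelNeZero_rename_prod_X_of_exists_eq_zero (by omega) hcard u (by simpa using ha)

end Cokernel

section MonomialIdeal

open MvPolynomial

variable {k ι : Type*} [Field k]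

/-- The exponents of the standard monomials of degree `i` for the monomial ideal with generating
exponents `G`: those of degree `i` which are not above any element of `G`. -/
def standardExponents (G : Set (ι →₀ ℕ)) (i : ℕ) : Set (ι →₀ ℕ) :=
  {s | s.degree = i ∧ ∀ g ∈ G, ¬ g ≤ s}

theorem restrictSupport_standardExponents_le (G : Set (ι →₀ ℕ)) (i : ℕ) :
    restrictSupport k (standardExponents G i) ≤ homogeneousSubmodule ι k i := by
  rw [homogeneousSubmodule_eq_finsupp_supported]
  exact restrictSupport_mono k fun s hs => hs.1

theorem eq_zero_of_mem_restrictSupport_standardExponents {G : Set (ι →₀ ℕ)} {i : ℕ}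
    {p : MvPolynomial ι k} (hp : p ∈ restrictSupport k (standardExponents G i))
    (hpI : p ∈ Ideal.span ((fun s => monomial s (1 : k)) '' G)) : p = 0 := by
  rw [mem_ideal_span_monomial_image] at hpI
  refine support_eq_empty.1 (Finset.eq_empty_of_forall_notMem fun s hs => ?_)
  obtain ⟨g, hg, hgs⟩ := hpI s hs
  exact ((mem_restrictSupport_iff k).1 hp hs).2 g hg hgs

theorem gradedPiece_eq_map_restrictSupport (G : Set (ι →₀ ℕ)) (i : ℕ) :
    gradedPiece (Ideal.span ((fun s => monomial s (1 : k)) '' G)) i =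
      (restrictSupport k (standardExponents G i)).map (Ideal.Quotient.mkₐ k _).toLinearMap := by
  refine le_antisymm ?_ (Submodule.map_mono (restrictSupport_standardExponents_le G i))
  rw [gradedPiece, homogeneousSubmodule_eq_finsupp_supported]
  change (restrictSupport k _).map _ ≤ _
  rw [restrictSupport_eq_span, Submodule.map_span_le]
  rintro _ ⟨s, hs, rfl⟩
  by_cases hG : ∃ g ∈ G, g ≤ s
  · have hmem : monomial s (1 : k) ∈ Ideal.span ((fun s => monomial s (1 : k)) '' G) := by
      rw [mem_ideal_span_monomial_image]
      intro x hx
      rwa [Finset.mem_singleton.1 (support_monomial_subset hx)]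
    rw [AlgHom.toLinearMap_apply, Ideal.Quotient.mkₐ_eq_mk, Ideal.Quotient.eq_zero_iff_mem.2 hmem]
    exact zero_mem _
  · push Not at hG
    exact Submodule.mem_map_of_mem ((monomial_mem_restrictSupport k).2 (Or.inl ⟨hs, hG⟩))

theorem finrank_gradedPiece (G : Set (ι →₀ ℕ)) (i : ℕ) :
    Module.finrank k (gradedPiece (Ideal.span ((fun s => monomial s (1 : k)) '' G)) i) =
      (standardExponents G i).ncard := by
  rw [gradedPiece_eq_map_restrictSupport, ← LinearMap.range_domRestrict,
    LinearMap.finrank_range_of_inj]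
  · exact Module.finrank_eq_nat_card_basis (basisRestrictSupport k (standardExponents G i))
  · rw [← LinearMap.ker_eq_bot, Submodule.eq_bot_iff]
    rintro ⟨p, hp⟩ hpI
    exact Subtype.ext
      (eq_zero_of_mem_restrictSupport_standardExponents hp (Ideal.Quotient.eq_zero_iff_mem.1 hpI))

theorem powerIdeal_sup_span_eq_span_monomial (d : ℕ) (f : ι →₀ ℕ) :
    powerIdeal k ι d ⊔ Ideal.span {monomial f 1} =
      Ideal.span ((fun s => monomial s (1 : k)) '' insert f (Set.range fun i => .single i d)) := by
  rw [powerIdeal, ← Ideal.span_union, Set.image_insert_eq, Set.union_singleton, ← Set.range_comp]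
  simp [Function.comp_def, X_pow_eq_monomial]

end MonomialIdeal

section HilbertFunction

open LaurentPolynomial

variable {k σ ι : Type*} [Field k]

/-- The Laurent polynomial `1 + T + ⋯ + T ^ (d - 1)`, the Hilbert series of `k[x]/(x ^ d)`. Laurent
polynomials are used so that coefficients are indexed by `ℤ`. -/
noncomputable def geom (d : ℕ) : ℤ[T;T⁻¹] := ∑ a ∈ Finset.range d, T 1 ^ a

theorem sum_Ico_T_one_pow (a b : ℕ) :
    ∑ i ∈ Finset.Ico a b, (T 1 : ℤ[T;T⁻¹]) ^ i = T 1 ^ a * geom (b - a) := by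
  simp only [Finset.sum_Ico_eq_sum_range, geom, Finset.mul_sum, pow_add]

theorem coeff_T_one_pow (a : ℕ) (j : ℤ) :
    ((T 1 : ℤ[T;T⁻¹]) ^ a).coeff j = if (a : ℤ) = j then 1 else 0 := by
  rw [T_pow, mul_one, T_apply]

theorem card_filter_piFinset_sum_eq_coeff [Fintype ι] [DecidableEq ι] (t : ι → Finset ℕ) (i : ℕ) :
    (((Fintype.piFinset t).filter fun s => ∑ j, s j = i).card : ℤ) =
      (∏ j, ∑ a ∈ t j, (T 1 : ℤ[T;T⁻¹]) ^ a).coeff i := by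
  rw [Finset.prod_univ_sum, AddMonoidAlgebra.coeff_sum, Finset.card_filter, Finset.sum_apply']
  push_cast
  refine Finset.sum_congr rfl fun s _ => ?_
  rw [Finset.prod_pow_eq_pow_sum, coeff_T_one_pow]
  norm_cast

theorem standardExponents_insert_range_single [Fintype ι] [DecidableEq ι] (d : ℕ) (f : ι →₀ ℕ)
    (i : ℕ) :
    Finsupp.equivFunOnFinite '' standardExponents (insert f (Set.range fun j => .single j d)) i =
      ((Fintype.piFinset fun _ : ι => Finset.range d).filter fun s => ∑ j, s j = i) \
        (Fintype.piFinset fun j => Finset.Ico (f j) d).filter fun s => ∑ j, s j = i := by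
  ext s
  have hle : f ≤ Finsupp.equivFunOnFinite.symm s ↔ ∀ j, f j ≤ s j := by simp [Finsupp.le_def]
  rw [Equiv.image_eq_preimage_symm]
  simp only [standardExponents, Set.mem_insert_iff, Set.mem_range, forall_eq_or_imp,
    forall_exists_index, forall_apply_eq_imp_iff, Set.mem_preimage, Set.mem_ofPred_eq,
    Finsupp.degree_eq_sum, hle, Finsupp.single_le_iff,
    Finsupp.coe_equivFunOnFinite_symm, Finset.coe_sdiff, Finset.coe_filter, Set.mem_sdiff,
    Fintype.mem_piFinset, Finset.mem_range, Finset.mem_Ico, not_le, forall_and]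
  tauto

theorem finrank_gradedPiece_powerIdeal_sup [Fintype ι] (d : ℕ) (f : ι →₀ ℕ) (i : ℕ) :
    (Module.finrank k (gradedPiece (powerIdeal k ι d ⊔
      Ideal.span {MvPolynomial.monomial f 1}) i) : ℤ) =
      (geom d ^ Fintype.card ι - ∏ j, T 1 ^ f j * geom (d - f j)).coeff i := by
  classical
  have hsub : (Fintype.piFinset fun j => Finset.Ico (f j) d).filter (fun s => ∑ j, s j = i) ⊆
      (Fintype.piFinset fun _ => Finset.range d).filter fun s => ∑ j, s j = i :=
    Finset.filter_subset_filter _ (Fintype.piFinset_subset _ _ fun j a ha => by simp_all)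
  rw [powerIdeal_sup_span_eq_span_monomial, finrank_gradedPiece,
    ← Set.ncard_image_of_injective _ Finsupp.equivFunOnFinite.injective,
    standardExponents_insert_range_single, Set.ncard_coe_finset,
    Finset.card_sdiff_of_subset hsub, Nat.cast_sub (Finset.card_le_card hsub),
    card_filter_piFinset_sum_eq_coeff, card_filter_piFinset_sum_eq_coeff]
  simp only [sum_Ico_T_one_pow, Finset.prod_const, Finset.card_univ, geom,
    AddMonoidAlgebra.coeff_sub, Finsupp.sub_apply]

theorem finrank_gradedPiece_powerIdeal_sup_rename [Fintype σ] [Fintype ι] {r : ℕ} (d : ℕ)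
    (g : σ → ℕ) (u : σ ↪ ι) (h : Fintype.card ι = Fintype.card σ + r) (i : ℕ) :
    (Module.finrank k (gradedPiece (powerIdeal k ι d ⊔
      Ideal.span {MvPolynomial.rename u (∏ j, MvPolynomial.X j ^ g j)}) i) : ℤ) =
      ((geom d ^ Fintype.card σ - ∏ j, T 1 ^ g j * geom (d - g j)) * geom d ^ r).coeff i := by
  obtain ⟨e, he⟩ := exists_sumEquiv_extending u h
  let f : σ →₀ ℕ := Finsupp.equivFunOnFinite.symm g
  have hmonomial : ∏ j, MvPolynomial.X j ^ g j = MvPolynomial.monomial f (1 : k) := by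
    simp [MvPolynomial.monomial_eq, Finsupp.prod_fintype, f]
  have hinl (j : σ) : f.mapDomain u (e (.inl j)) = g j := by
    rw [he, Finsupp.mapDomain_apply u.injective, Finsupp.equivFunOnFinite_symm_apply_apply]
  have hinr (s : Fin r) : f.mapDomain u (e (.inr s)) = 0 := by
    refine Finsupp.mapDomain_of_notMem_range _ _ fun ⟨j, hj⟩ => ?_
    simpa using e.injective ((he j).trans hj)
  rw [hmonomial, MvPolynomial.rename_monomial, finrank_gradedPiece_powerIdeal_sup, sub_mul,
    ← pow_add, ← h, ← e.prod_comp, Fintype.prod_sum_type]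
  simp only [hinl, hinr, pow_zero, one_mul, tsub_zero, Finset.prod_const, Finset.card_univ,
    Fintype.card_fin]

theorem coeff_T_one_pow_mul (a : ℕ) (p : ℤ[T;T⁻¹]) (j : ℤ) :
    (T 1 ^ a * p).coeff j = p.coeff (j - a) := by
  rw [T_pow, mul_one, T, AddMonoidAlgebra.coeff_single_mul_apply, one_mul, neg_add_eq_sub]

theorem coeff_geom_mul (d : ℕ) (p : ℤ[T;T⁻¹]) (j : ℤ) :
    (geom d * p).coeff j = ∑ a ∈ Finset.range d, p.coeff (j - a) := by
  simp only [geom, Finset.sum_mul, AddMonoidAlgebra.coeff_sum, Finset.sum_apply',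
    coeff_T_one_pow_mul]

theorem coeff_geom_mul_sub (d : ℕ) (p : ℤ[T;T⁻¹]) (j : ℤ) :
    (geom d * p).coeff j - (geom d * p).coeff (j - 1) = p.coeff j - p.coeff (j - d) := by
  have htel := Finset.sum_range_sub' (fun a : ℕ => p.coeff (j - a)) d
  rw [Nat.cast_zero, sub_zero] at htel
  rw [coeff_geom_mul, coeff_geom_mul, ← Finset.sum_sub_distrib, ← htel]
  refine Finset.sum_congr rfl fun a _ => ?_
  rw [Nat.cast_succ, sub_sub, add_comm (1 : ℤ)]

/-- The sequence `q` is symmetric about `c / 2` and decreases away from `c / 2`: a term is at most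
any term lying between it and its mirror image. -/
def SymmUnimodal (c : ℤ) (q : ℤ → ℤ) : Prop :=
  ∀ i j, min j (c - j) ≤ i → i ≤ max j (c - j) → q j ≤ q i

theorem SymmUnimodal.reflect {c : ℤ} {q : ℤ → ℤ} (h : SymmUnimodal c q) {i j : ℤ}
    (hij : i + j = c) : q i = q j :=
  le_antisymm (h _ _ (by lia) (by lia)) (h _ _ (by lia) (by lia))

theorem SymmUnimodal.of_le {c : ℤ} {q : ℤ → ℤ} (hr : ∀ i, q (c - i) = q i)
    (hs : ∀ i, 2 * i ≤ c + 1 → q (i - 1) ≤ q i) : SymmUnimodal c q := by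
  have hmono : ∀ j i, j ≤ i → 2 * i ≤ c + 1 → q j ≤ q i := by
    intro j i hji
    induction i, hji using Int.leInduction with
    | base => exact fun _ => le_rfl
    | succ i _ ih =>
      intro hi
      simpa using (ih (by lia)).trans ((hs (i + 1) hi).trans_eq' (by simp))
  intro i j h1 h2
  rcases le_total (2 * i) c with hi | hi <;> rcases le_total (2 * j) c with hj | hj
  · exact hmono _ _ (by lia) (by lia)
  · rw [← hr j]; exact hmono _ _ (by lia) (by lia)
  · rw [← hr i]; exact hmono _ _ (by lia) (by lia)
  · rw [← hr i, ← hr j]; exact hmono _ _ (by lia) (by lia)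

theorem SymmUnimodal.geom_mul {c : ℤ} {p : ℤ[T;T⁻¹]} (h : SymmUnimodal c p.coeff) {d : ℕ}
    (hd : 1 ≤ d) : SymmUnimodal (c + (d - 1)) (geom d * p).coeff := by
  refine SymmUnimodal.of_le (fun i => ?_) (fun i hi => ?_)
  · rw [coeff_geom_mul, coeff_geom_mul, ← Finset.sum_range_reflect]
    refine Finset.sum_congr rfl fun a ha => ?_
    have := Finset.mem_range.1 ha
    exact h.reflect (by lia)
  · rw [← sub_nonneg, coeff_geom_mul_sub, sub_nonneg]
    exact h i (i - d) (by lia) (by lia)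

theorem symmUnimodal_geom_pow {d : ℕ} (hd : 1 ≤ d) (r : ℕ) :
    SymmUnimodal (r * (d - 1)) (geom d ^ r).coeff := by
  induction r with
  | zero =>
    intro i j _ _
    rw [pow_zero, ← pow_zero (T 1), coeff_T_one_pow, coeff_T_one_pow]
    split_ifs <;> lia
  | succ r ih =>
    rw [pow_succ']
    convert ih.geom_mul hd using 1
    push_cast
    ring

theorem SymmUnimodal.coeff_geom_mul_sub_le {c : ℤ} {p : ℤ[T;T⁻¹]} (h : SymmUnimodal c p.coeff)
    {d : ℕ} {i j : ℤ} (hij : i ≤ j) (hc : c ≤ i + j) (hd : i + j ≤ c + 2 * d) :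
    (geom d * p).coeff j - (geom d * p).coeff (j - 1) ≤
      (geom d * p).coeff i - (geom d * p).coeff (i - 1) := by
  rw [coeff_geom_mul_sub, coeff_geom_mul_sub]
  exact sub_le_sub (h _ _ (by lia) (by lia)) (h _ _ (by lia) (by lia))

theorem SymmUnimodal.coeff_geom_mul_peak_le {c : ℤ} {p : ℤ[T;T⁻¹]} (h : SymmUnimodal c p.coeff)
    {d : ℕ} (hd : 5 ≤ d) {t : ℤ} (ht : 2 * t = c + (d - 1)) :
    (geom d * p).coeff t + (geom d * p).coeff (t - d + 2) + (geom d * p).coeff (t - d + 1) ≤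
      (geom d * p).coeff (t - 1) + (geom d * p).coeff (t - 2) + (geom d * p).coeff (t - 3) := by
  have hg := h.geom_mul (d := d) (by lia)
  have hconcave := h.coeff_geom_mul_sub_le (d := d) (i := t - 2) (j := t)
    (by lia) (by lia) (by lia)
  rw [show t - 2 - 1 = t - 3 by ring] at hconcave
  have h1 := hg (t - 3) (t - d + 2) (by lia) (by lia)
  have h2 := hg (t - 3) (t - d + 1) (by lia) (by lia)
  linarith

theorem coeff_geom_sq_sub_mul_le {d : ℕ} (hd : 5 ≤ d) {c M : ℤ} {p : ℤ[T;T⁻¹]}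
    (hp : SymmUnimodal c p.coeff) (hM : 2 * M = c + 3 * (d - 1)) :
    ((geom d ^ 2 - T 1 ^ d * (geom (d - 3) * geom 3)) * (geom d * p)).coeff M ≤
      ((geom d ^ 2 - T 1 ^ d * (geom (d - 3) * geom 3)) * (geom d * p)).coeff (M - 1) := by
  have hpeak := hp.coeff_geom_mul_peak_le hd (t := M - d + 1) (by linarith)
  have hq := hp.geom_mul (d := d) (by lia)
  set q := geom d * p
  have hfst : (geom d * (geom d * q)).coeff M - (geom d * (geom d * q)).coeff (M - 1) =
      q.coeff (M - d + 1) - q.coeff (M - 2 * d + 1) := by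
    have hmirror := (hq.geom_mul (d := d) (by lia)).reflect (i := M - d) (j := M + 1) (by linarith)
    have hmirror' := hq.reflect (i := M + 1) (j := M - 2 * d + 1) (by linarith)
    have hnext := coeff_geom_mul_sub d q (M + 1)
    rw [add_sub_cancel_right, show M + 1 - d = M - d + 1 by ring] at hnext
    rw [coeff_geom_mul_sub]
    linarith
  have hsnd : (geom (d - 3) * (geom 3 * q)).coeff (M - d) -
      (geom (d - 3) * (geom 3 * q)).coeff (M - d - 1) =
      q.coeff (M - d) + q.coeff (M - d - 1) + q.coeff (M - d - 2) -
        (q.coeff (M - 2 * d + 3) + q.coeff (M - 2 * d + 2) + q.coeff (M - 2 * d + 1)) := by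
    rw [coeff_geom_mul_sub, coeff_geom_mul, coeff_geom_mul]
    simp only [Finset.sum_range_succ, Finset.sum_range_zero]
    push_cast [show 3 ≤ d by lia]
    ring_nf
  rw [sub_mul, pow_two, mul_assoc, mul_assoc, mul_assoc]
  simp only [AddMonoidAlgebra.coeff_sub, Finsupp.sub_apply, coeff_T_one_pow_mul]
  ring_nf at *
  linarith

theorem coeff_geom_four_pow_sub_mul_le {c M : ℤ} {p : ℤ[T;T⁻¹]} (hp : SymmUnimodal c p.coeff)
    (hM : 2 * M = c + 12) :
    ((geom 4 ^ 4 - T 1 ^ 4 * geom 3 ^ 4) * p).coeff M ≤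
      ((geom 4 ^ 4 - T 1 ^ 4 * geom 3 ^ 4) * p).coeff (M - 1) := by
  have hexpand : (geom 4 ^ 4 - T 1 ^ 4 * geom 3 ^ 4) * p =
      T 1 ^ 0 * p + (4 : ℤ) • (T 1 ^ 1 * p) + (10 : ℤ) • (T 1 ^ 2 * p)
      + (20 : ℤ) • (T 1 ^ 3 * p) + (30 : ℤ) • (T 1 ^ 4 * p) + (36 : ℤ) • (T 1 ^ 5 * p)
      + (34 : ℤ) • (T 1 ^ 6 * p) + (24 : ℤ) • (T 1 ^ 7 * p) + (12 : ℤ) • (T 1 ^ 8 * p)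
      + (4 : ℤ) • (T 1 ^ 9 * p) := by
    simp only [geom, Finset.sum_range_succ, Finset.sum_range_zero, zsmul_eq_mul]
    push_cast
    ring
  simp only [hexpand, AddMonoidAlgebra.coeff_add, AddMonoidAlgebra.coeff_smul, Finsupp.add_apply,
    Finsupp.smul_apply, coeff_T_one_pow_mul, smul_eq_mul, sub_sub]
  norm_num
  linarith [hp.reflect (show M - 7 + (M - 5) = c by lia),
    hp.reflect (show M - 8 + (M - 4) = c by lia), hp.reflect (show M - 9 + (M - 3) = c by lia),
    hp.reflect (show M - 10 + (M - 2) = c by lia), hp (M - 6) (M - 5) (by lia) (by lia),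
    hp (M - 5) (M - 4) (by lia) (by lia), hp (M - 4) (M - 3) (by lia) (by lia),
    hp (M - 3) (M - 2) (by lia) (by lia), hp (M - 2) (M - 1) (by lia) (by lia),
    hp (M - 1) M (by lia) (by lia)]

theorem coeff_geom_three_pow_sub_mul_le {c M : ℤ} {p : ℤ[T;T⁻¹]} (hp : SymmUnimodal c p.coeff)
    (hM : 2 * M = c + 6) :
    ((geom 3 ^ 3 - T 1 ^ 3 * geom 2 ^ 3) * p).coeff M ≤
      ((geom 3 ^ 3 - T 1 ^ 3 * geom 2 ^ 3) * p).coeff (M - 1) := by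
  have hexpand : (geom 3 ^ 3 - T 1 ^ 3 * geom 2 ^ 3) * p =
      T 1 ^ 0 * p + (3 : ℤ) • (T 1 ^ 1 * p) + (6 : ℤ) • (T 1 ^ 2 * p) + (6 : ℤ) • (T 1 ^ 3 * p)
      + (3 : ℤ) • (T 1 ^ 4 * p) := by
    simp only [geom, Finset.sum_range_succ, Finset.sum_range_zero, zsmul_eq_mul]
    push_cast
    ring
  simp only [hexpand, AddMonoidAlgebra.coeff_add, AddMonoidAlgebra.coeff_smul, Finsupp.add_apply,
    Finsupp.smul_apply, coeff_T_one_pow_mul, smul_eq_mul, sub_sub]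
  norm_num
  linarith [hp.reflect (show M - 4 + (M - 2) = c by lia),
    hp.reflect (show M - 5 + (M - 1) = c by lia), hp (M - 3) (M - 2) (by lia) (by lia),
    hp (M - 2) (M - 1) (by lia) (by lia), hp (M - 1) M (by lia) (by lia)]

end HilbertFunction

section Failure

open MvPolynomial

variable {k σ ι : Type*} [Field k] [Fintype σ] [Fintype ι] {d m : ℕ}

theorem failsWLPInDegree_of_coeff_le {r M : ℕ} {g : σ → ℕ} {u : σ ↪ ι} {μ : MvPolynomial σ k}
    (hμ : ∏ j, X j ^ g j = μ) (h : Fintype.card ι = Fintype.card σ + r) (hM : 1 ≤ M)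
    (hcoker : ∀ a, CokernelNeZero (powerIdeal k ι d ⊔ Ideal.span {rename u μ}) a M)
    (hcoeff : ((geom d ^ Fintype.card σ - ∏ j, .T 1 ^ g j * geom (d - g j)) * geom d ^ r).coeff M ≤
      ((geom d ^ Fintype.card σ - ∏ j, .T 1 ^ g j * geom (d - g j)) * geom d ^ r).coeff (M - 1)) :
    FailsWLPInDegree (powerIdeal k ι d ⊔ Ideal.span {rename u μ}) (M - 1) := by
  obtain ⟨i, rfl⟩ := Nat.exists_eq_add_of_le' hM
  refine failsWLPInDegree_of_finrank_le hcoker ?_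
  zify
  rw [← hμ, finrank_gradedPiece_powerIdeal_sup_rename d g u h,
    finrank_gradedPiece_powerIdeal_sup_rename d g u h]
  simpa using hcoeff

theorem failsWLPInDegree_rename_X_pow_three_mul_X_pow (hd : 5 ≤ d) (hcard : Fintype.card ι = 2 * m)
    (hm : 2 ≤ m) (u : Fin 2 ↪ ι) :
    FailsWLPInDegree (powerIdeal k ι d ⊔ Ideal.span {rename u (X 0 ^ 3 * X 1 ^ (d - 3))})
      (m * (d - 1) - 1) := by
  obtain ⟨p, rfl⟩ := Nat.exists_eq_add_of_le' hm
  have hnumerator : ∏ j, .T 1 ^ ![3, d - 3] j * geom (d - ![3, d - 3] j) =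
      .T 1 ^ d * (geom (d - 3) * geom 3) := by
    rw [Fin.prod_univ_two, mul_mul_mul_comm, ← pow_add]
    simp only [Matrix.cons_val_zero, Matrix.cons_val_one]
    rw [Nat.add_sub_of_le (by omega), Nat.sub_sub_self (by omega)]
  refine failsWLPInDegree_of_coeff_le (g := ![3, d - 3]) (r := 1 + (2 * p + 1))
    (by simp [Fin.prod_univ_two]) (by rw [hcard, Fintype.card_fin]; ring)
    (Nat.mul_pos (by omega) (by omega))
    (cokernelNeZero_rename_X_pow_mul_X_pow (by omega) (by omega) hcard u) ?_
  rw [Fintype.card_fin, hnumerator, pow_add, pow_one]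
  refine coeff_geom_sq_sub_mul_le hd (symmUnimodal_geom_pow (by omega) (2 * p + 1)) ?_
  push_cast [show 1 ≤ d by omega]
  ring

theorem failsWLPInDegree_four_rename_prod_X (hcard : Fintype.card ι = 2 * m) (u : Fin 4 ↪ ι) :
    FailsWLPInDegree (powerIdeal k ι 4 ⊔ Ideal.span {rename u (∏ i, X i)}) (m * (4 - 1) - 1) := by
  obtain ⟨p, rfl⟩ := Nat.exists_eq_add_of_le' (le_of_embedding_fin_two_mul (q := 2) u hcard)
  refine failsWLPInDegree_of_coeff_le (g := 1) (r := 2 * p) (by simp)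
    (by rw [hcard, Fintype.card_fin]; ring) (by omega)
    (cokernelNeZero_rename_prod_X_of_even (q := 2) (by omega) hcard u) ?_
  simp only [Pi.one_apply, Finset.prod_const, Finset.card_univ, Fintype.card_fin, mul_pow, pow_one]
  refine coeff_geom_four_pow_sub_mul_le (symmUnimodal_geom_pow (by omega) (2 * p)) ?_
  push_cast
  ring

theorem failsWLPInDegree_three_rename_prod_X (hcard : Fintype.card ι = 2 * m) (hm : 3 ≤ m)
    (u : Fin 3 ↪ ι) :
    FailsWLPInDegree (powerIdeal k ι 3 ⊔ Ideal.span {rename u (∏ i, X i)}) (m * (3 - 1) - 1) := by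
  obtain ⟨p, rfl⟩ := Nat.exists_eq_add_of_le' hm
  refine failsWLPInDegree_of_coeff_le (g := 1) (r := 2 * p + 3) (by simp)
    (by rw [hcard, Fintype.card_fin]; ring) (by omega)
    (cokernelNeZero_rename_prod_X_of_odd (q := 1) le_rfl hcard hm u) ?_
  simp only [Pi.one_apply, Finset.prod_const, Finset.card_univ, Fintype.card_fin, mul_pow, pow_one]
  refine coeff_geom_three_pow_sub_mul_le (symmUnimodal_geom_pow (by omega) (2 * p + 3)) ?_
  push_cast
  ring

end Failure

end Lefschetz

open Lefschetz MvPolynomial in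
theorem proposition5p5_general {k ι : Type*} [Field k] [Fintype ι] {m : ℕ}
    (hcard : Fintype.card ι = 2 * m) :
    (∀ d, 5 ≤ d → 2 ≤ m → ∀ u : Fin 2 ↪ ι,
      FailsWLPInDegree
        (Ideal.span (Set.range (fun i : ι => (X i : MvPolynomial ι k) ^ d) ∪
          {X (u 0) ^ 3 * X (u 1) ^ (d - 3)}))
        (m * (d - 1) - 1)) ∧
    (∀ u : Fin 4 ↪ ι,
      FailsWLPInDegree
        (Ideal.span (Set.range (fun i : ι => (X i : MvPolynomial ι k) ^ 4) ∪
          {X (u 0) * X (u 1) * X (u 2) * X (u 3)}))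
        (m * (4 - 1) - 1)) ∧
    (3 ≤ m → ∀ u : Fin 3 ↪ ι,
      FailsWLPInDegree
        (Ideal.span (Set.range (fun i : ι => (X i : MvPolynomial ι k) ^ 3) ∪
          {X (u 0) * X (u 1) * X (u 2)}))
        (m * (3 - 1) - 1)) := by
  simp only [Ideal.span_union]
  refine ⟨fun d hd hm u => ?_, fun u => ?_, fun hm u => ?_⟩
  · simpa [powerIdeal] using failsWLPInDegree_rename_X_pow_three_mul_X_pow (k := k) hd hcard hm u
  · simpa [powerIdeal, Fin.prod_univ_four] using
      failsWLPInDegree_four_rename_prod_X (k := k) hcard u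
  · simpa [powerIdeal, Fin.prod_univ_three] using
      failsWLPInDegree_three_rename_prod_X (k := k) hcard hm u

theorem proposition5p5 {k : Type*} [Field k] [CharZero k] (n m : ℕ) (hn : n = 2 * m) :
    (∀ (d : ℕ) (_ : 5 ≤ d) (_ : 4 ≤ n),
      Lefschetz.FailsWLPInDegree
        (Ideal.span (Set.range (fun i : Fin n => (MvPolynomial.X i : MvPolynomial (Fin n) k) ^ d) ∪
          {MvPolynomial.X ⟨0, by omega⟩ ^ 3 * MvPolynomial.X ⟨1, by omega⟩ ^ (d - 3)}))
        (m * (d - 1) - 1)) ∧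
    (∀ (_ : 4 ≤ n),
      Lefschetz.FailsWLPInDegree
        (Ideal.span (Set.range (fun i : Fin n => (MvPolynomial.X i : MvPolynomial (Fin n) k) ^ 4) ∪
          {MvPolynomial.X ⟨0, by omega⟩ * MvPolynomial.X ⟨1, by omega⟩ *
            MvPolynomial.X ⟨2, by omega⟩ * MvPolynomial.X ⟨3, by omega⟩}))
        (m * (4 - 1) - 1)) ∧
    (∀ (_ : 6 ≤ n),
      Lefschetz.FailsWLPInDegree
        (Ideal.span (Set.range (fun i : Fin n => (MvPolynomial.X i : MvPolynomial (Fin n) k) ^ 3) ∪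
          {MvPolynomial.X ⟨0, by omega⟩ * MvPolynomial.X ⟨1, by omega⟩ *
            MvPolynomial.X ⟨2, by omega⟩}))
        (m * (3 - 1) - 1)) := by
  obtain ⟨hfive, hfour, hthree⟩ := proposition5p5_general (k := k) ((Fintype.card_fin n).trans hn)
  exact ⟨fun d hd hn4 => hfive d hd (by omega) (Fin.castLEEmb (by omega)),
    fun hn4 => hfour (Fin.castLEEmb hn4), fun hn6 => hthree (by omega) (Fin.castLEEmb (by omega))⟩
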